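/- **Setting.** Let $\mathcal U$ and $\mathcal V$ be symmetric monoidal closed categories, each of which is locally small, locally finitely presentable, complete and cocomplete, regular, and such that finite tensor products of finitely presentable objects (including the unit) are finitely presentable. Let $F\dashv G$, with $F:\mathcal U\to\mathcal V$ and $G:\mathcal V\to\mathcal U$, be a monoidal adjunction: $F$ and $G$ are lax monoidal functors and the unit and counit are monoidal natural transformations. Let $\mathcal C$ be a $\mathcal V$-category (for instance a small one), and let $G_*\mathcal C$ be the $\mathcal U$-category with the same objects, hom-objects $G(\mathcal C(x,y))$, and identities and compositions induced by the lax structure of $G$. For $\mathcal W\in\{\mathcal U,\mathcal V\}$ and a $\mathcal W$-category $\mathcal X$, a *sieve* on $x\in\mathcal X$ is a subobject of $\mathcal X(-,x)$ in the category of $\mathcal W$-functors $\mathcal X^{\mathrm{op}}\to\mathcal W$ and $\mathcal W$-natural transformations, i.e. an isomorphism class of transformations $R\rightarrowtail\mathcal X(-,x)$ all of whose components are monomorphisms. Given a sieve $R$ on $x$ and $f:w\to\mathcal X(y,x)$ in $\mathcal W$, the sieve $R_f$ on $y$ is the (pointwise) pullback of $\mathcal X(-,y)\xrightarrow{f}\{w,\mathcal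 X(-,x)\}\leftarrowtail\{w,R\}$, where $\{w,B\}$ is the cotensor, $\{w,B\}(z)=\mathcal W(w,Bz)$, and the first map is induced by $f$ through composition in $\mathcal X$. For a family $\mathcal G$ of objects of $\mathcal W$, a *$\mathcal W$-coverage* on $\mathcal X$ (with respect to $\mathcal G$) is an assignment $J$ to each object $x$ of a set $J(x)$ of sieves on $x$ such that * (T1) $\mathcal X(-,x)\in J(x)$ for every $x$; * (T2) for all $x,y$, all $R\in J(x)$, all $g\in\mathcal G$ and all $f:g\to\mathcal X(y,x)$ in $\mathcal W$, one has $R_f\in J(y)$. For a $\mathcal V$-functor $R:\mathcal C^{\mathrm{op}}\to\mathcal V$, let $\widetilde G R:(G_*\mathcal C)^{\mathrm{op}}\to\mathcal U$ be the $\mathcal U$-functor with values $G(R(x))$ and structure morphisms $G(\mathcal C(x,y))\to G(\mathcal V(Ry,Rx))\to\mathcal U(GRy,GRx)$, where the second morphism is the transpose of $G(\mathcal V(Ry,Rx))\otimes GRy\to G(\mathcal V(Ry,Rx)\otimes Ry)\to GRx$. Since $\widetilde G\,\mathcal C(-,x)=G_*\mathcal C(-,x)$ and $G$ preserves monomorphisms,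 $\widetilde G$ sends a sieve $R$ on $x\in\mathcal C$ to a sieve $\widetilde G R$ on $x\in G_*\mathcal C$. **Statement.** Let $\mathcal G_{\mathcal U}$ be a (small) dense generating family of finitely presentable objects of $\mathcal U$, and let $\mathcal G_{\mathcal V}$ be a family of objects of $\mathcal V$ that contains $Fg$ for every $g\in\mathcal G_{\mathcal U}$; for instance $\mathcal G_{\mathcal V}=F\mathcal G_{\mathcal U}=\{Fg: g\in\mathcal G_{\mathcal U}\}$. Suppose that $G$ is faithful and conservative. If $J$ is a $\mathcal V$-coverage on $\mathcal C$ with respect to $\mathcal G_{\mathcal V}$, then the assignment $$x\longmapsto \widetilde G J(x)=\{\widetilde G R : R\in J(x)\}$$ is a $\mathcal U$-coverage on $G_*\mathcal C$ with respect to $\mathcal G_{\mathcal U}$. -/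

import Mathlib

open CategoryTheory MonoidalCategory Limits Opposite

open scoped MonoidalClosed

universe w u₁ u₂ u₃

set_option linter.unusedSectionVars false

noncomputable section

namespace EnrichedBase

/-! ### Standing hypotheses on a base of enrichment -/

/-- The standing hypotheses on a symmetric monoidal closed category `V` over which one enriches.
`V` is locally small (its hom-sets live in `Type w`), locally finitely presentable, complete and
cocomplete (in a closed `V`, ordinary small (co)limits are the conical (co)limits of the
self-enriched `V`), finite tensor products of finitely presentable objects are finitely
presentable, and `V` is a regular category. -/
class IsBase (V : Type u₁) [Category.{w} V] [MonoidalCategory V] [SymmetricCategory V]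
    [MonoidalClosed V] : Prop where
  locallyFinitelyPresentable : IsLocallyFinitelyPresentable.{w} V
  hasLimits : HasLimitsOfSize.{w, w} V
  hasColimits : HasColimitsOfSize.{w, w} V
  isFinitelyPresentable_unit : IsFinitelyPresentable.{w} (𝟙_ V)
  isFinitelyPresentable_tensor (a b : V) (ha : IsFinitelyPresentable.{w} a)
    (hb : IsFinitelyPresentable.{w} b) : IsFinitelyPresentable.{w} (a ⊗ b)
  regular : Regular V

instance (priority := 100) IsBase.hasPullbacks (V : Type u₁) [Category.{w} V] [MonoidalCategory V]
    [SymmetricCategory V] [MonoidalClosed V] [IsBase V] : HasPullbacks V :=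
  have := IsBase.hasLimits (V := V)
  { has_limit := fun F => HasLimitsOfShape.has_limit F }

/-- A small dense generating family of finitely presentable objects. -/
structure IsDenseGeneratingFamily {V : Type u₁} [Category.{w} V] (𝒢 : ObjectProperty V) :
    Prop where
  small : ObjectProperty.Small.{w} 𝒢
  dense : 𝒢.ι.IsDense
  isFinitelyPresentable (g : V) (hg : 𝒢 g) : IsFinitelyPresentable.{w} g

/-! ### Presheaves -/

section Presheaf

variable (V : Type u₁) [Category.{w} V] [MonoidalCategory V] [SymmetricCategory V]
  [MonoidalClosed V] (C : Type u₂) [EnrichedCategory V C]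

/-- A `V`-presheaf on the `V`-category `C`: a `V`-functor from `Cᵒᵖ` to the self-enriched `V`. -/
structure Presheaf extends EnrichedFunctor V Cᵒᵖ V

end Presheaf

section Basic

variable {V : Type u₁} [Category.{w} V] [MonoidalCategory V] [SymmetricCategory V]
  [MonoidalClosed V] {C : Type u₂} [EnrichedCategory V C]

/-- The transpose `C(x,y) ⊗ a ⟶ b` of a morphism `C(x,y) ⟶ [a,b]`. -/
def transpose {a b h : V} (m : h ⟶ (ihom a).obj b) : h ⊗ a ⟶ b :=
  (β_ h a).hom ≫ MonoidalClosed.uncurry m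

/-- The inverse of `transpose`. -/
def untranspose {a b h : V} (t : h ⊗ a ⟶ b) : h ⟶ (ihom a).obj b :=
  MonoidalClosed.curry ((β_ a h).hom ≫ t)

@[simp]
lemma transpose_untranspose {a b h : V} (t : h ⊗ a ⟶ b) : transpose (untranspose t) = t := by
  simp [transpose, untranspose]

@[simp]
lemma untranspose_transpose {a b h : V} (m : h ⟶ (ihom a).obj b) :
    untranspose (transpose m) = m := by
  simp [transpose, untranspose]

lemma transpose_injective {a b h : V} {m m' : h ⟶ (ihom a).obj b}
    (e : transpose m = transpose m') : m = m' := by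
  rw [← untranspose_transpose m, e, untranspose_transpose]

lemma transpose_comp_left {a b h h' : V} (k : h' ⟶ h) (m : h ⟶ (ihom a).obj b) :
    transpose (k ≫ m) = k ▷ a ≫ transpose m := by
  simp [transpose, MonoidalClosed.uncurry_natural_left]

lemma transpose_comp_map {a b b' h : V} (m : h ⟶ (ihom a).obj b) (k : b ⟶ b') :
    transpose (m ≫ (ihom a).map k) = transpose m ≫ k := by
  simp [transpose, MonoidalClosed.uncurry_natural_right]

lemma transpose_comp_pre {a a' b h : V} (m : h ⟶ (ihom a).obj b) (k : a' ⟶ a) :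
    transpose (m ≫ (MonoidalClosed.pre k).app b) = h ◁ k ≫ transpose m := by
  simp [transpose, MonoidalClosed.uncurry_pre_app]

lemma transpose_id (a : V) : transpose (MonoidalClosed.id a) = (λ_ a).hom := by
  simp [transpose, MonoidalClosed.id_eq]

lemma transpose_comp {a b c h k : V} (m : h ⟶ (ihom a).obj b) (n : k ⟶ (ihom b).obj c) :
    transpose ((β_ k h).hom ≫ (m ⊗ₘ n) ≫ MonoidalClosed.comp a b c) =
      (α_ k h a).hom ≫ k ◁ transpose m ≫ transpose n := by
  have h₁ : transpose ((β_ k h).hom ≫ (m ⊗ₘ n) ≫ MonoidalClosed.comp a b c) =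
      (β_ (k ⊗ h) a).hom ≫ a ◁ (β_ k h).hom ≫ (α_ a h k).inv ≫
        MonoidalClosed.uncurry m ▷ k ≫ MonoidalClosed.uncurry n := by
    simp only [transpose, MonoidalClosed.uncurry_natural_left, MonoidalClosed.comp_eq,
      MonoidalClosed.uncurry_curry, MonoidalClosed.compTranspose_eq]
    simp [MonoidalClosed.uncurry_eq, MonoidalCategory.tensorHom_def,
      ← MonoidalCategory.whisker_exchange_assoc]
  rw [h₁]
  simp only [transpose, MonoidalCategory.whiskerLeft_comp, Category.assoc,
    BraidedCategory.braiding_naturality_right_assoc, BraidedCategory.braiding_tensor_left_hom,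
    BraidedCategory.braiding_tensor_right_hom]

end Basic

namespace Presheaf

section Construction

variable {V : Type u₁} [Category.{w} V] [MonoidalCategory V] [SymmetricCategory V]
  [MonoidalClosed V] {C : Type u₂} [EnrichedCategory V C]

/-- The value `R(x)` of a presheaf at an object `x` of `C`. -/
def at' (R : Presheaf V C) (x : C) : V := R.obj (op x)

/-- The structure morphism `C(x,y) ⟶ [R(y), R(x)]` of a presheaf. -/
def homMap (R : Presheaf V C) (x y : C) : (x ⟶[V] y) ⟶ (ihom (R.at' y)).obj (R.at' x) :=
  R.map (op y) (op x)

/-- The action `C(x,y) ⊗ R(y) ⟶ R(x)`, i.e. the transpose of the structure morphism. -/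
def act (R : Presheaf V C) (x y : C) : (x ⟶[V] y) ⊗ R.at' y ⟶ R.at' x :=
  transpose (R.homMap x y)

lemma act_id (R : Presheaf V C) (x : C) :
    eId V x ▷ R.at' x ≫ R.act x x = (λ_ (R.at' x)).hom := by
  rw [act, ← transpose_comp_left, ← transpose_id]
  exact congrArg transpose (R.map_id (op x))

lemma act_comp (R : Presheaf V C) (x y z : C) :
    eComp V x y z ▷ R.at' z ≫ R.act x z =
      (α_ _ _ _).hom ≫ (x ⟶[V] y) ◁ R.act y z ≫ R.act x y := by
  have h := R.map_comp (op z) (op y) (op x)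
  rw [eComp_op_eq, Category.assoc] at h
  replace h := (β_ (x ⟶[V] y) (y ⟶[V] z)).hom ≫= h
  replace h := (SymmetricCategory.symmetry_assoc _ _ _).symm.trans h
  rw [act, act, act, ← transpose_comp_left, ← transpose_comp]
  exact congrArg transpose h

/-- A presheaf from its values and its structure morphisms `C(x,y) ⟶ [R(y), R(x)]`, where the
functor laws are checked on the transposes `C(x,y) ⊗ R(y) ⟶ R(x)`. -/
def ofHomMap (obj : C → V) (m : ∀ x y : C, (x ⟶[V] y) ⟶ (ihom (obj y)).obj (obj x))
    (m_id : ∀ x, eId V x ▷ obj x ≫ transpose (m x x) = (λ_ (obj x)).hom)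
    (m_comp : ∀ x y z, eComp V x y z ▷ obj z ≫ transpose (m x z) =
      (α_ _ _ _).hom ≫ (x ⟶[V] y) ◁ transpose (m y z) ≫ transpose (m x y)) :
    Presheaf V C where
  obj x := obj x.unop
  map x y := m y.unop x.unop
  map_id x := by
    apply transpose_injective
    refine (transpose_comp_left _ _).trans ((m_id x.unop).trans ?_)
    exact (transpose_id _).symm
  map_comp x y z := by
    apply transpose_injective
    rw [eComp_op_eq, Category.assoc]
    have h := (transpose_comp_left (eComp V z.unop y.unop x.unop) (m z.unop x.unop)).trans
      ((m_comp z.unop y.unop x.unop).trans (transpose_comp _ _).symm)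
    have h' := (β_ _ _).hom ≫= transpose_injective h
    rw [SymmetricCategory.symmetry_assoc] at h'
    exact congrArg transpose h'

/-- A presheaf from its values and its actions `C(x,y) ⊗ R(y) ⟶ R(x)`. -/
def ofAct (obj : C → V) (a : ∀ x y : C, (x ⟶[V] y) ⊗ obj y ⟶ obj x)
    (a_id : ∀ x, eId V x ▷ obj x ≫ a x x = (λ_ (obj x)).hom)
    (a_comp : ∀ x y z, eComp V x y z ▷ obj z ≫ a x z =
      (α_ _ _ _).hom ≫ (x ⟶[V] y) ◁ a y z ≫ a x y) :
    Presheaf V C :=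
  ofHomMap obj (fun x y => untranspose (a x y)) (by simpa using a_id) (by simpa using a_comp)

@[simp]
lemma act_ofAct (obj : C → V) (a : ∀ x y : C, (x ⟶[V] y) ⊗ obj y ⟶ obj x) (a_id) (a_comp)
    (x y : C) : (ofAct obj a a_id a_comp).act x y = a x y :=
  transpose_untranspose _

/-- A `V`-natural transformation between presheaves: a family of morphisms `R(x) ⟶ S(x)` of `V`
such that the two composites `C(x,y) ⟶ [R(y), R(x)] ⟶ [R(y), S(x)]` and
`C(x,y) ⟶ [S(y), S(x)] ⟶ [R(y), S(x)]` agree. -/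
@[ext]
structure Hom (R S : Presheaf V C) where
  app (x : C) : R.at' x ⟶ S.at' x
  naturality (x y : C) : R.homMap x y ≫ (ihom (R.at' y)).map (app x) =
    S.homMap x y ≫ (MonoidalClosed.pre (app y)).app (S.at' x)

lemma naturality_iff (R S : Presheaf V C) (app : ∀ x, R.at' x ⟶ S.at' x) (x y : C) :
    R.homMap x y ≫ (ihom (R.at' y)).map (app x) =
      S.homMap x y ≫ (MonoidalClosed.pre (app y)).app (S.at' x) ↔
    R.act x y ≫ app x = (x ⟶[V] y) ◁ app y ≫ S.act x y := by
  rw [act, act, ← transpose_comp_map, ← transpose_comp_pre]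
  exact ⟨congrArg transpose, transpose_injective⟩

lemma Hom.act_app {R S : Presheaf V C} (t : Hom R S) (x y : C) :
    R.act x y ≫ t.app x = (x ⟶[V] y) ◁ t.app y ≫ S.act x y :=
  (naturality_iff R S t.app x y).1 (t.naturality x y)

/-- The identity transformation. -/
def Hom.id (R : Presheaf V C) : Hom R R where
  app x := 𝟙 _
  naturality x y := by simp

/-- The vertical composite of transformations. -/
def Hom.comp {R S T : Presheaf V C} (s : Hom R S) (t : Hom S T) : Hom R T where
  app x := s.app x ≫ t.app x
  naturality x y := by
    rw [naturality_iff R T (fun x => s.app x ≫ t.app x) x y, ← Category.assoc, s.act_app,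
      Category.assoc, t.act_app, whiskerLeft_comp_assoc]

/-- The category `[Cᵒᵖ, V]₀` of presheaves and `V`-natural transformations. -/
instance : Category (Presheaf V C) where
  Hom R S := Hom R S
  id R := Hom.id R
  comp s t := Hom.comp s t
  id_comp s := Hom.ext (funext fun x => Category.id_comp (s.app x))
  comp_id s := Hom.ext (funext fun x => Category.comp_id (s.app x))
  assoc s t r := Hom.ext (funext fun x => Category.assoc (s.app x) (t.app x) (r.app x))

/-- The component at `x` of a morphism of presheaves. -/
def app {R S : Presheaf V C} (t : R ⟶ S) (x : C) : R.at' x ⟶ S.at' x := Hom.app t x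

@[ext]
lemma hom_ext {R S : Presheaf V C} {s t : R ⟶ S} (h : ∀ x, app s x = app t x) : s = t :=
  Hom.ext (funext h)

@[simp]
lemma id_app (R : Presheaf V C) (x : C) : app (𝟙 R) x = 𝟙 _ := rfl

@[simp]
lemma comp_app {R S T : Presheaf V C} (s : R ⟶ S) (t : S ⟶ T) (x : C) :
    app (s ≫ t) x = app s x ≫ app t x := rfl

lemma act_app {R S : Presheaf V C} (t : R ⟶ S) (x y : C) :
    R.act x y ≫ app t x = (x ⟶[V] y) ◁ app t y ≫ S.act x y :=
  Hom.act_app t x y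

/-- A morphism of presheaves from components that are compatible with the actions. -/
def homMk {R S : Presheaf V C} (f : ∀ x, R.at' x ⟶ S.at' x)
    (hf : ∀ x y, R.act x y ≫ f x = (x ⟶[V] y) ◁ f y ≫ S.act x y) : R ⟶ S :=
  Hom.mk f fun x y => (naturality_iff R S f x y).2 (hf x y)

@[simp]
lemma app_homMk {R S : Presheaf V C} (f : ∀ x, R.at' x ⟶ S.at' x) (hf) (x : C) :
    app (homMk (R := R) (S := S) f hf) x = f x := rfl

/-! ### Representable presheaves, cotensors, pullbacks -/

/-- The representable presheaf `C(-,x)`, acting by composition. -/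
def yo (x : C) : Presheaf V C :=
  ofAct (fun y => (y ⟶[V] x)) (fun y z => eComp V y z x)
    (fun y => by rw [← cancel_epi (λ_ (y ⟶[V] x)).inv, e_id_comp]; simp)
    (fun y z t => (e_assoc' V y z t x).symm)

/-- Evaluation `v ⊗ [v, b] ⟶ b`. -/
def ev (v b : V) : v ⊗ (ihom v).obj b ⟶ b := (ihom.ev v).app b

lemma whiskerLeft_ev {a v b : V} (m : a ⟶ (ihom v).obj b) :
    v ◁ m ≫ ev v b = MonoidalClosed.uncurry m :=
  (MonoidalClosed.uncurry_eq m).symm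

/-- The morphism `v ⊗ (h ⊗ [v, b]) ≅ h ⊗ (v ⊗ [v, b]) ⟶ h ⊗ b`. -/
def shuffleEv (v h b : V) : v ⊗ h ⊗ (ihom v).obj b ⟶ h ⊗ b :=
  (α_ _ _ _).inv ≫ (β_ v h).hom ▷ _ ≫ (α_ _ _ _).hom ≫ h ◁ ev v b

lemma whiskerRight_shuffleEv (v : V) {h h' : V} (k : h ⟶ h') (b : V) :
    v ◁ k ▷ _ ≫ shuffleEv v h' b = shuffleEv v h b ≫ k ▷ b := by
  simp only [shuffleEv, Category.assoc]
  rw [associator_inv_naturality_middle_assoc, ← comp_whiskerRight_assoc,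
    BraidedCategory.braiding_naturality_right, comp_whiskerRight_assoc,
    associator_naturality_left_assoc, ← whisker_exchange]

lemma whiskerLeft_shuffleEv (v h : V) {c b : V} (m : c ⟶ (ihom v).obj b) :
    v ◁ h ◁ m ≫ shuffleEv v h b =
      (α_ _ _ _).inv ≫ (β_ v h).hom ▷ c ≫ (α_ _ _ _).hom ≫ h ◁ MonoidalClosed.uncurry m := by
  simp only [shuffleEv, ← whiskerLeft_ev, MonoidalCategory.whiskerLeft_comp]
  rw [associator_inv_naturality_right_assoc, whisker_exchange_assoc,
    associator_naturality_right_assoc]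

lemma act_yo (x y z : C) : (yo (V := V) z).act x y = eComp V x y z :=
  act_ofAct _ _ _ _ x y

/-- The action `h ⊗ [v, b] ⟶ [v, b']` induced by an action `h ⊗ b ⟶ b'`: the transpose of
`v ⊗ (h ⊗ [v, b]) ≅ h ⊗ (v ⊗ [v, b]) ⟶ h ⊗ b ⟶ b'`. -/
def cotensorAct (v : V) {h b b' : V} (a : h ⊗ b ⟶ b') : h ⊗ (ihom v).obj b ⟶ (ihom v).obj b' :=
  MonoidalClosed.curry (shuffleEv v h b ≫ a)

lemma uncurry_cotensorAct (v : V) {h b b' : V} (a : h ⊗ b ⟶ b') :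
    MonoidalClosed.uncurry (cotensorAct v a) = shuffleEv v h b ≫ a :=
  MonoidalClosed.uncurry_curry _

lemma uncurry_whiskerLeft_cotensorAct (v : V) {h c b b' : V} (m : c ⟶ (ihom v).obj b)
    (a : h ⊗ b ⟶ b') :
    MonoidalClosed.uncurry (h ◁ m ≫ cotensorAct v a) =
      (α_ _ _ _).inv ≫ (β_ v h).hom ▷ c ≫ (α_ _ _ _).hom ≫ h ◁ MonoidalClosed.uncurry m ≫ a := by
  rw [MonoidalClosed.uncurry_natural_left, uncurry_cotensorAct, ← Category.assoc,
    whiskerLeft_shuffleEv]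
  simp only [Category.assoc]

lemma cotensorAct_map (v : V) {h a a' b b' : V} (p : h ⊗ a ⟶ a') (q : h ⊗ b ⟶ b') (t : a ⟶ b)
    (t' : a' ⟶ b') (e : p ≫ t' = h ◁ t ≫ q) :
    cotensorAct v p ≫ (ihom v).map t' = h ◁ (ihom v).map t ≫ cotensorAct v q := by
  apply MonoidalClosed.uncurry_injective
  rw [MonoidalClosed.uncurry_natural_right, uncurry_cotensorAct, Category.assoc, e,
    uncurry_whiskerLeft_cotensorAct, MonoidalClosed.uncurry_ihom_map, shuffleEv]
  simp [ev]

/-- At each `z`, the component `C(z,y) ⟶ [v, C(z,x)]` induced by a generalized element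
`f : v ⟶ C(y,x)`: the transpose of `v ⊗ C(z,y) ≅ C(z,y) ⊗ v ⟶ C(z,y) ⊗ C(y,x) ⟶ C(z,x)`. -/
def elementApp {v : V} {x y : C} (f : v ⟶ (y ⟶[V] x)) (z : C) :
    (z ⟶[V] y) ⟶ (ihom v).obj (z ⟶[V] x) :=
  MonoidalClosed.curry ((β_ v (z ⟶[V] y)).hom ≫ (z ⟶[V] y) ◁ f ≫ eComp V z y x)

lemma elementApp_natural {v : V} {x y : C} (f : v ⟶ (y ⟶[V] x)) (z t : C) :
    eComp V z t y ≫ elementApp f z =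
      (z ⟶[V] t) ◁ elementApp f t ≫ cotensorAct v (eComp V z t x) := by
  apply MonoidalClosed.uncurry_injective
  rw [uncurry_whiskerLeft_cotensorAct, MonoidalClosed.uncurry_natural_left, elementApp,
    elementApp, MonoidalClosed.uncurry_curry, MonoidalClosed.uncurry_curry,
    BraidedCategory.braiding_naturality_right_assoc, ← whisker_exchange_assoc, ← e_assoc',
    BraidedCategory.braiding_tensor_right_hom]
  simp

/-- The cotensor `{v, B}` of a presheaf `B` by an object `v` of `V`: its value at `x` is the
internal hom `[v, B(x)]`. -/
def cotensor (v : V) (B : Presheaf V C) : Presheaf V C :=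
  ofAct (fun x => (ihom v).obj (B.at' x)) (fun x y => cotensorAct v (B.act x y))
    (fun x => by
      apply MonoidalClosed.uncurry_injective
      rw [MonoidalClosed.uncurry_natural_left, uncurry_cotensorAct,
        ← Category.assoc, whiskerRight_shuffleEv, Category.assoc, act_id,
        ← whiskerLeft_ev, shuffleEv]
      simp [braiding_tensorUnit_right])
    (fun x y z => by
      apply MonoidalClosed.uncurry_injective
      rw [MonoidalClosed.uncurry_natural_left, uncurry_cotensorAct,
        ← Category.assoc, whiskerRight_shuffleEv, Category.assoc, act_comp,
        MonoidalClosed.uncurry_natural_left, uncurry_whiskerLeft_cotensorAct,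
        uncurry_cotensorAct]
      simp [shuffleEv])

lemma act_cotensor (v : V) (B : Presheaf V C) (x y : C) :
    (cotensor v B).act x y = cotensorAct v (B.act x y) :=
  act_ofAct _ _ _ _ x y

/-- The morphism `{v, t} : {v, A} ⟶ {v, B}` induced by `t : A ⟶ B`. -/
def cotensorMap (v : V) {A B : Presheaf V C} (t : A ⟶ B) : cotensor v A ⟶ cotensor v B :=
  homMk (fun x => (ihom v).map (app t x)) (fun x y => by
    rw [act_cotensor, act_cotensor]
    exact cotensorAct_map v _ _ _ _ (act_app t x y))

/-- The morphism `C(-,y) ⟶ {v, C(-,x)}` induced by a generalized element `f : v ⟶ C(y,x)`. -/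
def ofElement {v : V} {x y : C} (f : v ⟶ (y ⟶[V] x)) : yo (V := V) y ⟶ cotensor v (yo x) :=
  homMk (fun z => elementApp f z) (fun z t => by
    rw [act_cotensor, act_yo, act_yo]
    exact elementApp_natural f z t)

variable [HasPullbacks V]

section

variable {A B D : Presheaf V C} (s : A ⟶ D) (t : B ⟶ D)

/-- The action on the pointwise pullback. -/
def pbAct (x y : C) : (x ⟶[V] y) ⊗ Limits.pullback (app s y) (app t y) ⟶
    Limits.pullback (app s x) (app t x) :=
  pullback.lift
    ((x ⟶[V] y) ◁ pullback.fst (app s y) (app t y) ≫ A.act x y)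
    ((x ⟶[V] y) ◁ pullback.snd (app s y) (app t y) ≫ B.act x y)
    (by
      rw [Category.assoc, Category.assoc, act_app, act_app, ← whiskerLeft_comp_assoc,
        ← whiskerLeft_comp_assoc, pullback.condition])

lemma pbAct_fst (x y : C) : pbAct s t x y ≫ pullback.fst (app s x) (app t x) =
    (x ⟶[V] y) ◁ pullback.fst (app s y) (app t y) ≫ A.act x y :=
  pullback.lift_fst _ _ _

lemma pbAct_snd (x y : C) : pbAct s t x y ≫ pullback.snd (app s x) (app t x) =
    (x ⟶[V] y) ◁ pullback.snd (app s y) (app t y) ≫ B.act x y :=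
  pullback.lift_snd _ _ _

/-- The pullback of a cospan of presheaves, computed pointwise. -/
def pb : Presheaf V C :=
  ofAct (fun x => Limits.pullback (app s x) (app t x)) (pbAct s t)
    (fun x => by
      apply pullback.hom_ext
      · rw [Category.assoc, pbAct_fst, ← whisker_exchange_assoc, act_id]; simp
      · rw [Category.assoc, pbAct_snd, ← whisker_exchange_assoc, act_id]; simp)
    (fun x y z => by
      apply pullback.hom_ext
      · rw [Category.assoc, pbAct_fst, ← whisker_exchange_assoc, act_comp, Category.assoc,
          Category.assoc, pbAct_fst, ← whiskerLeft_comp_assoc, pbAct_fst]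
        simp
      · rw [Category.assoc, pbAct_snd, ← whisker_exchange_assoc, act_comp, Category.assoc,
          Category.assoc, pbAct_snd, ← whiskerLeft_comp_assoc, pbAct_snd]
        simp)

lemma act_pb (x y : C) : (pb s t).act x y = pbAct s t x y :=
  act_ofAct _ _ _ _ x y

/-- The first projection of the pointwise pullback. -/
def pbFst : pb s t ⟶ A :=
  homMk (fun x => pullback.fst (app s x) (app t x)) (fun x y => by
    rw [act_pb]; exact pbAct_fst s t x y)

end

end Construction

/-! ### Change of base for presheaves -/

section ChangeBase

open Functor.LaxMonoidal

variable {U : Type u₁} [Category.{w} U] [MonoidalCategory U] [SymmetricCategory U]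
  [MonoidalClosed U] {V : Type u₂} [Category.{w} V] [MonoidalCategory V] [SymmetricCategory V]
  [MonoidalClosed V] (G : V ⥤ U) [G.LaxMonoidal]

/-- The action `G[a, b] ⟶ [Ga, Gb]` on hom-objects of the `U`-functor `G_*V ⟶ U` that is induced
by the lax monoidal functor `G`: it is the transpose of
`G[a, b] ⊗ Ga ⟶ G([a, b] ⊗ a) ⟶ Gb`. -/
def homComparison (a b : V) : G.obj ((ihom a).obj b) ⟶ (ihom (G.obj a)).obj (G.obj b) :=
  untranspose (μ G _ _ ≫ G.map (transpose (𝟙 ((ihom a).obj b))))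

lemma transpose_map_homComparison {a b h : V} (m : h ⟶ (ihom a).obj b) :
    transpose (G.map m ≫ homComparison G a b) = μ G h a ≫ G.map (transpose m) := by
  rw [transpose_comp_left, homComparison, transpose_untranspose, μ_natural_left_assoc,
    ← G.map_comp, ← transpose_comp_left, Category.comp_id]

variable {C : Type u₃} [EnrichedCategory V C]

lemma changeBase_id (R : Presheaf V C) (x : C) :
    (ε G ≫ G.map (eId V x)) ▷ G.obj (R.at' x) ≫ μ G _ _ ≫ G.map (R.act x x) =
      (λ_ (G.obj (R.at' x))).hom := by
  rw [comp_whiskerRight_assoc, μ_natural_left_assoc, ← G.map_comp, act_id,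
    left_unitality G (R.at' x)]

lemma changeBase_comp (R : Presheaf V C) (x y z : C) :
    (μ G _ _ ≫ G.map (eComp V x y z)) ▷ G.obj (R.at' z) ≫ μ G _ _ ≫ G.map (R.act x z) =
      (α_ _ _ _).hom ≫ G.obj (x ⟶[V] y) ◁ (μ G _ _ ≫ G.map (R.act y z)) ≫
        μ G _ _ ≫ G.map (R.act x y) := by
  rw [comp_whiskerRight_assoc, μ_natural_left_assoc, ← G.map_comp, act_comp, G.map_comp,
    associativity_assoc, G.map_comp, ← μ_natural_right_assoc, whiskerLeft_comp_assoc]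

/-- Change of base of a presheaf: `R : Cᵒᵖ ⟶ V` is sent to the `U`-presheaf on `G_*C` with values
`G(R(x))` and structure morphisms `G(C(x,y)) ⟶ G[R(y), R(x)] ⟶ [G(R(y)), G(R(x))]`. -/
def changeBase (R : Presheaf V C) : Presheaf U (TransportEnrichment G C) :=
  ofHomMap (C := TransportEnrichment G C) (fun x : C => G.obj (R.at' x))
    (fun x y : C => G.map (R.homMap x y) ≫ homComparison G (R.at' y) (R.at' x))
    (fun x => by
      rw [transpose_map_homComparison]
      exact changeBase_id G R x)
    (fun x y z => by
      rw [transpose_map_homComparison, transpose_map_homComparison, transpose_map_homComparison]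
      exact changeBase_comp G R x y z)

lemma act_changeBase (R : Presheaf V C) (x y : C) :
    (changeBase G R).act x y = μ G (x ⟶[V] y) (R.at' y) ≫ G.map (R.act x y) :=
  transpose_map_homComparison G (R.homMap x y)

/-- Change of base of a morphism of presheaves: its components are the `G(t_x)`. -/
def changeBaseMap {R S : Presheaf V C} (t : R ⟶ S) : changeBase G R ⟶ changeBase G S :=
  homMk (C := TransportEnrichment G C) (fun x : C => G.map (app t x)) (fun x y : C => by
    rw [act_changeBase, act_changeBase]
    have h : μ G (x ⟶[V] y) (R.at' y) ≫ G.map (R.act x y) ≫ G.map (app t x) =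
        G.obj (x ⟶[V] y) ◁ G.map (app t y) ≫ μ G _ _ ≫ G.map (S.act x y) := by
      rw [← G.map_comp, act_app, G.map_comp, μ_natural_right_assoc]
    exact (Category.assoc _ _ _).trans h)

/-- The canonical identification of the change of base of `C(-,x)` with `G_*C(-,x)`; all its
components are identities. -/
def changeBaseYo (x : C) :
    changeBase G (yo (V := V) x) ⟶ yo (V := U) (C := TransportEnrichment G C) x :=
  homMk (C := TransportEnrichment G C) (fun y : C => 𝟙 (G.obj (y ⟶[V] x))) (fun y z : C => by
    have h : (μ G _ _ ≫ G.map (eComp V y z x)) ≫ 𝟙 (G.obj (y ⟶[V] x)) =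
        G.obj (y ⟶[V] z) ◁ 𝟙 (G.obj (z ⟶[V] x)) ≫ μ G _ _ ≫ G.map (eComp V y z x) := by simp
    rw [act_changeBase, act_yo]
    exact h.trans (congrArg (_ ≫ ·)
      (act_yo (V := U) (C := TransportEnrichment G C) y z x).symm))

end ChangeBase

end Presheaf

/-! ### Subobjects and sieves -/

open Presheaf

section Sub

variable {V : Type u₁} [Category.{w} V] [MonoidalCategory V] [SymmetricCategory V]
  [MonoidalClosed V] {C : Type u₂} [EnrichedCategory V C]

/-- A monomorphism of presheaves with codomain `K`: all components are monomorphisms in `V`. -/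
structure MonoInto (K : Presheaf V C) where
  dom : Presheaf V C
  ι : dom ⟶ K
  mono (x : C) : Mono (app ι x)

/-- Two monomorphisms `r`, `s` into `K` are equivalent if `r = s ∘ t` for some isomorphism `t`. -/
def MonoInto.Equiv {K : Presheaf V C} (r s : MonoInto K) : Prop :=
  ∃ t : r.dom ≅ s.dom, t.hom ≫ s.ι = r.ι

lemma MonoInto.exists_hom {K : Presheaf V C} (r s : MonoInto K)
    (h : ∀ x, ∃ g : r.dom.at' x ⟶ s.dom.at' x, g ≫ app s.ι x = app r.ι x) :
    ∃ t : r.dom ⟶ s.dom, t ≫ s.ι = r.ι := by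
  choose g hg using h
  refine ⟨homMk g fun x y => ?_, hom_ext hg⟩
  have := s.mono x
  rw [← cancel_mono (app s.ι x), Category.assoc, Category.assoc, hg, act_app, act_app,
    ← whiskerLeft_comp_assoc, hg]

/-- Monomorphisms that factor through each other in each component are equivalent. -/
lemma MonoInto.equiv_of_factors {K : Presheaf V C} (r s : MonoInto K)
    (h : ∀ x, ∃ g : r.dom.at' x ⟶ s.dom.at' x, g ≫ app s.ι x = app r.ι x)
    (h' : ∀ x, ∃ g : s.dom.at' x ⟶ r.dom.at' x, g ≫ app r.ι x = app s.ι x) : r.Equiv s := by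
  obtain ⟨t, ht⟩ := MonoInto.exists_hom r s h
  obtain ⟨t', ht'⟩ := MonoInto.exists_hom s r h'
  refine ⟨⟨t, t', hom_ext fun x => ?_, hom_ext fun x => ?_⟩, ht⟩
  · have := r.mono x
    rw [← cancel_mono (app r.ι x), ← comp_app, Category.assoc, ht', ht, id_app, Category.id_comp]
  · have := s.mono x
    rw [← cancel_mono (app s.ι x), ← comp_app, Category.assoc, ht, ht', id_app, Category.id_comp]

lemma MonoInto.Equiv.symm {K : Presheaf V C} {r s : MonoInto K} (h : r.Equiv s) : s.Equiv r := by
  obtain ⟨t, ht⟩ := h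
  exact ⟨t.symm, by rw [← ht]; simp⟩

lemma MonoInto.Equiv.exists_factor {K : Presheaf V C} {r s : MonoInto K} (h : r.Equiv s) (x : C) :
    ∃ g : r.dom.at' x ⟶ s.dom.at' x, g ≫ app s.ι x = app r.ι x := by
  obtain ⟨t, ht⟩ := h
  exact ⟨app t.hom x, by rw [← comp_app, ht]⟩

instance MonoInto.setoid (K : Presheaf V C) : Setoid (MonoInto K) where
  r := MonoInto.Equiv
  iseqv :=
    { refl := fun r => ⟨Iso.refl _, Category.id_comp _⟩
      symm := fun h => h.symm
      trans := fun ⟨t, ht⟩ ⟨t', ht'⟩ => ⟨t ≪≫ t', by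
        rw [Iso.trans_hom, Category.assoc, ht', ht]⟩ }

/-- Subobjects of a presheaf. -/
def Sub (K : Presheaf V C) := Quotient (MonoInto.setoid K)

variable (V) in
/-- A sieve on `x` is a subobject of the representable presheaf `C(-,x)`. -/
def Sieve (x : C) := Sub (yo (V := V) x)

/-- The maximal sieve `C(-,x)` on `x`. -/
def Sieve.top (x : C) : Sieve V x :=
  Quotient.mk _ ⟨yo x, 𝟙 _, fun _ => inferInstanceAs (Mono (𝟙 _))⟩

variable [HasPullbacks V]

/-- For a monomorphism `R ⟶ C(-,x)` and `f : v ⟶ C(y,x)`, the monomorphism `R_f ⟶ C(-,y)`, where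
`R_f` is the pullback of `C(-,y) ⟶ {v, C(-,x)} ⟵ {v, R}`. -/
def MonoInto.pull {v : V} {x y : C} (f : v ⟶ (y ⟶[V] x)) (r : MonoInto (yo (V := V) x)) :
    MonoInto (yo (V := V) y) where
  dom := pb (ofElement f) (cotensorMap v r.ι)
  ι := pbFst (ofElement f) (cotensorMap v r.ι)
  mono z := by
    have := r.mono z
    have : Mono (app (cotensorMap v r.ι) z) := inferInstanceAs (Mono ((ihom v).map (app r.ι z)))
    exact inferInstanceAs
      (Mono (pullback.fst (app (ofElement f) z) (app (cotensorMap v r.ι) z)))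

lemma MonoInto.pull_factor {v : V} {x y : C} (f : v ⟶ (y ⟶[V] x))
    {r s : MonoInto (yo (V := V) x)} (h : r.Equiv s) (z : C) :
    ∃ g : (r.pull f).dom.at' z ⟶ (s.pull f).dom.at' z,
      g ≫ app (s.pull f).ι z = app (r.pull f).ι z := by
  obtain ⟨t, ht⟩ := h
  have w : pullback.fst (app (ofElement f) z) (app (cotensorMap v r.ι) z) ≫ app (ofElement f) z =
      (pullback.snd (app (ofElement f) z) (app (cotensorMap v r.ι) z) ≫
        app (cotensorMap v t.hom) z) ≫ app (cotensorMap v s.ι) z := by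
    have e : app (cotensorMap v r.ι) z =
        app (cotensorMap v t.hom) z ≫ app (cotensorMap v s.ι) z := by
      change (ihom v).map (app r.ι z) = (ihom v).map (app t.hom z) ≫ (ihom v).map (app s.ι z)
      rw [← Functor.map_comp, ← comp_app, ht]
    rw [pullback.condition, Category.assoc, ← e]
  exact ⟨pullback.lift _ _ w, pullback.lift_fst _ _ w⟩

/-- The pullback `R_f` of a sieve `R` on `x` along a generalized element `f : v ⟶ C(y,x)`. -/
def Sieve.pull {v : V} {x y : C} (f : v ⟶ (y ⟶[V] x)) : Sieve V x → Sieve V y :=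
  Quotient.map (MonoInto.pull f) fun _ _ h =>
    MonoInto.equiv_of_factors _ _ (MonoInto.pull_factor f h) (MonoInto.pull_factor f h.symm)

/-- `V`-coverages on `C`, with respect to a family `𝒢` of objects of `V`: a family `J(x)` of sieves
on each object `x`, which contains the maximal sieve `C(-,x)` and such that `R_f ∈ J(y)` for all
`R ∈ J(x)` and all `f : g ⟶ C(y,x)` with `g` in `𝒢`. -/
structure IsCoverage (𝒢 : ObjectProperty V) (J : ∀ x : C, Set (Sieve V x)) : Prop where
  top_mem (x : C) : Sieve.top x ∈ J x
  pull_mem (x y : C) (R : Sieve V x) (hR : R ∈ J x) (g : V) (hg : 𝒢 g) (f : g ⟶ (y ⟶[V] x)) :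
    R.pull f ∈ J y

end Sub

/-! ### Change of base for sieves -/

section ChangeBase

variable {U : Type u₁} [Category.{w} U] [MonoidalCategory U] [SymmetricCategory U]
  [MonoidalClosed U] {V : Type u₂} [Category.{w} V] [MonoidalCategory V] [SymmetricCategory V]
  [MonoidalClosed V] {F : U ⥤ V} {G : V ⥤ U} [G.LaxMonoidal] (adj : F ⊣ G)
  {C : Type u₃} [EnrichedCategory V C]

/-- Change of base of a monomorphism `R ⟶ C(-,x)` along a right adjoint `G`. -/
def MonoInto.changeBase {x : C} (r : MonoInto (yo (V := V) x)) :
    MonoInto (yo (V := U) (C := TransportEnrichment G C) x) where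
  dom := Presheaf.changeBase G r.dom
  ι := changeBaseMap G r.ι ≫ changeBaseYo G x
  mono y := by
    have := r.mono y
    have := adj.isRightAdjoint
    have h : Mono (G.map (app (C := C) r.ι y)) := inferInstance
    rw [← Category.comp_id (G.map _)] at h
    exact h

lemma MonoInto.changeBase_factor {x : C} {r s : MonoInto (yo (V := V) x)} (h : r.Equiv s)
    (z : TransportEnrichment G C) :
    ∃ g : (r.changeBase adj).dom.at' z ⟶ (s.changeBase adj).dom.at' z,
      g ≫ app (s.changeBase adj).ι z = app (r.changeBase adj).ι z := by
  obtain ⟨g, hg⟩ := h.exists_factor (C := C) z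
  refine ⟨G.map g, ?_⟩
  change G.map g ≫ G.map (app (C := C) s.ι z) ≫ 𝟙 _ = G.map (app (C := C) r.ι z) ≫ 𝟙 _
  rw [Category.comp_id, Category.comp_id, ← G.map_comp, hg]

/-- Change of base of a sieve on `x`: the sieve `G̃R` on the object `x` of `G_*C`. -/
def Sieve.changeBase {x : C} :
    Sieve V x → Sieve U (C := TransportEnrichment G C) x :=
  Quotient.map (MonoInto.changeBase adj) fun _ _ h =>
    MonoInto.equiv_of_factors _ _ (MonoInto.changeBase_factor adj h)
      (MonoInto.changeBase_factor adj h.symm)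

/-- Change of base of a family of sieves: `x ↦ {G̃R | R ∈ J(x)}`. -/
def changeBaseFamily (J : ∀ x : C, Set (Sieve V x)) (x : TransportEnrichment G C) :
    Set (Sieve U x) :=
  Sieve.changeBase (C := C) adj '' J x

end ChangeBase

end EnrichedBase

end

/-! A sieve is determined by the generalized elements `u ⟶ C(z,y)` that factor through it, so
equalities of sieves reduce to membership tests. By the closed structure, `a : u ⟶ C(z,y)` lies in
`R_f`, for `f : v ⟶ C(y,x)`, exactly when the composite `u ⊗ v ⟶ C(z,y) ⊗ C(y,x) ⟶ C(z,x)` lies in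
`R` (`MonoInto.factors_pull_iff`). By the adjunction, an element of `G(C(z,x))` lies in `G̃R`
exactly when its transpose lies in `R` (`MonoInto.factors_changeBase_iff`).

For (T2), let `f : g ⟶ G(C(y,x))` have transpose `f' : Fg ⟶ C(y,x)`. The claim is `(G̃R)_f =
G̃(R_{f'})` (`Sieve.pull_changeBase`); since `Fg` belongs to the family on `V`, the sieve `R_{f'}`
is in `J(y)`. For `a : u ⟶ G(C(z,y))` with transpose `a'`, membership in the left side concerns a
morphism out of `F(u ⊗ g)`, and membership in the right side the composite of `a' ⊗ f'` out of `Fu ⊗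
Fg`. Restricting the former along the tensorator `Fu ⊗ Fg ⟶ F(u ⊗ g)` gives the latter, by
monoidality of the counit. Monoidality of the unit gives the tensorator a section, so factorizations
pass in both directions (`factors_tensorHom_comp_map_iff`).

(T1) holds because `G` preserves identities. -/

namespace EnrichedBase

open Presheaf Functor.LaxMonoidal

/-! ### Pulled-back sieves in terms of generalized elements -/

section Pull

variable {V : Type u₁} [Category.{w} V] [MonoidalCategory V] [SymmetricCategory V]
  [MonoidalClosed V] {C : Type u₂} [EnrichedCategory V C] [HasPullbacks V]

/-- Morphisms into the pullback of `b ⟶ [v, d] ⟵ [v, r]`, where `b ⟶ [v, d]` is induced by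
`p : b ⊗ c ⟶ d` and `f : v ⟶ c`, in terms of factorizations through `r ⟶ d`. -/
lemma factors_pullback_fst_iff {u v b c d r : V} (a : u ⟶ b) (f : v ⟶ c) (p : b ⊗ c ⟶ d)
    (m : r ⟶ d) :
    (∃ k, k ≫ pullback.fst (MonoidalClosed.curry ((β_ v b).hom ≫ b ◁ f ≫ p))
        ((ihom v).map m) = a) ↔
      ∃ h : u ⊗ v ⟶ r, h ≫ m = (a ⊗ₘ f) ≫ p := by
  -- Currying takes the variable `v` on the left, whereas composition needs it on the right; hence
  -- the braiding.
  have key (a : u ⟶ b) :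
      MonoidalClosed.uncurry (a ≫ MonoidalClosed.curry ((β_ v b).hom ≫ b ◁ f ≫ p)) =
        (β_ v u).hom ≫ (a ⊗ₘ f) ≫ p := by
    rw [MonoidalClosed.uncurry_natural_left, MonoidalClosed.uncurry_curry,
      BraidedCategory.braiding_naturality_right_assoc, MonoidalCategory.tensorHom_def,
      Category.assoc]
  constructor
  · rintro ⟨k, rfl⟩
    -- The first projection of `k` is `a` itself; the factorization through `m` is the transpose of
    -- the second.
    refine ⟨(β_ u v).hom ≫ MonoidalClosed.uncurry (k ≫ pullback.snd _ _), ?_⟩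
    rw [Category.assoc, ← MonoidalClosed.uncurry_natural_right, Category.assoc,
      ← pullback.condition, ← Category.assoc, key, SymmetricCategory.symmetry_assoc]
  · rintro ⟨h, hh⟩
    refine ⟨pullback.lift a (MonoidalClosed.curry ((β_ v u).hom ≫ h)) ?_, pullback.lift_fst _ _ _⟩
    apply MonoidalClosed.uncurry_injective
    rw [key, MonoidalClosed.uncurry_natural_right, MonoidalClosed.uncurry_curry,
      Category.assoc, hh]

/-- A generalized element `a` of `C(z,y)` lies in `R_f` if and only if the composite `f ∘ a` lies
in `R`. -/
lemma MonoInto.factors_pull_iff {v u : V} {x y : C} (f : v ⟶ (y ⟶[V] x))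
    (r : MonoInto (yo (V := V) x)) (z : C) (a : u ⟶ (z ⟶[V] y)) :
    (∃ k : u ⟶ (r.pull f).dom.at' z, k ≫ app (r.pull f).ι z = a) ↔
      ∃ h : u ⊗ v ⟶ r.dom.at' z, h ≫ app r.ι z = (a ⊗ₘ f) ≫ eComp V z y x :=
  factors_pullback_fst_iff a f (eComp V z y x) (app r.ι z)

/-- Monomorphisms through which the same generalized elements factor are equivalent. -/
lemma MonoInto.equiv_of_factors_iff {K : Presheaf V C} (r s : MonoInto K)
    (h : ∀ (x : C) (u : V) (a : u ⟶ K.at' x),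
      (∃ k, k ≫ app r.ι x = a) ↔ ∃ k, k ≫ app s.ι x = a) : r.Equiv s :=
  -- The universal generalized element: each inclusion factors through itself by the identity, hence
  -- through the other.
  MonoInto.equiv_of_factors r s (fun x => (h x _ _).1 ⟨𝟙 _, Category.id_comp _⟩)
    (fun x => (h x _ _).2 ⟨𝟙 _, Category.id_comp _⟩)

end Pull

/-! ### Factorizations and transposes along a monoidal adjunction -/

section Adjunction

variable {U : Type u₁} [Category.{w} U] {V : Type u₂} [Category.{w} V] {F : U ⥤ V} {G : V ⥤ U}
  (adj : F ⊣ G)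

/-- A morphism factors through `G.map m` if and only if its transpose factors through `m`. -/
lemma factors_map_iff {u : U} {b c : V} (m : b ⟶ c) (a : u ⟶ G.obj c) :
    (∃ k : u ⟶ G.obj b, k ≫ G.map m = a) ↔
      ∃ k : F.obj u ⟶ b, k ≫ m = (adj.homEquiv u c).symm a := by
  constructor
  · rintro ⟨k, rfl⟩
    exact ⟨(adj.homEquiv _ _).symm k, (adj.homEquiv_naturality_right_symm _ _).symm⟩
  · rintro ⟨k, hk⟩
    exact ⟨adj.homEquiv _ _ k, by rw [← adj.homEquiv_naturality_right, hk, Equiv.apply_symm_apply]⟩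

variable [MonoidalCategory U] [MonoidalCategory V] [F.LaxMonoidal] [G.LaxMonoidal]

/-- The left adjoint of a monoidal adjunction has split epimorphisms as its tensorators. -/
lemma adjoint_tensorators_comp_μ [NatTrans.IsMonoidal adj.unit] (a b : U) :
    (adj.homEquiv (a ⊗ b) (F.obj a ⊗ F.obj b)).symm
        ((adj.unit.app a ⊗ₘ adj.unit.app b) ≫ μ G (F.obj a) (F.obj b)) ≫ μ F a b = 𝟙 _ := by
  -- Monoidality expresses the unit at `a ⊗ b` as `(η_a ⊗ η_b) ≫ μ G ≫ G.map (μ F)`. Transposing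
  -- this identity gives the claim, as the unit is the transpose of an identity.
  have h := NatTrans.IsMonoidal.tensor (τ := adj.unit) a b
  rw [id_μ, Category.id_comp, comp_μ] at h
  rw [← adj.homEquiv_naturality_right_symm, Category.assoc]
  erw [← h]
  rw [Equiv.symm_apply_eq, adj.homEquiv_unit, CategoryTheory.Functor.map_id]
  exact (Category.comp_id _).symm

/-- Naturality of `μ F` moves it past `F.map (a ⊗ₘ f)`; monoidality of the counit then absorbs both
tensorators into a tensor product of counits. This compares composition in `G_*C` with composition
of transposes in `C`. -/
lemma μ_comp_homEquiv_symm [NatTrans.IsMonoidal adj.counit] {u v : U} {b c : V}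
    (a : u ⟶ G.obj b) (f : v ⟶ G.obj c) :
    μ F u v ≫ (adj.homEquiv (u ⊗ v) (b ⊗ c)).symm ((a ⊗ₘ f) ≫ μ G b c) =
      (adj.homEquiv u b).symm a ⊗ₘ (adj.homEquiv v c).symm f := by
  have h := NatTrans.IsMonoidal.tensor (τ := adj.counit) b c
  rw [id_μ, Category.comp_id, comp_μ, Category.assoc] at h
  rw [adj.homEquiv_counit, adj.homEquiv_counit, adj.homEquiv_counit, Functor.map_comp,
    Category.assoc, ← μ_natural_assoc, ← MonoidalCategory.tensorHom_comp_tensorHom]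
  exact congrArg (_ ≫ ·) h

/-- A composite of `a ⊗ f` with `p : b ⊗ c ⟶ d` factors through `G.map m` if and only if the
corresponding composite of the transposes of `a` and `f` factors through `m`. -/
lemma factors_tensorHom_comp_map_iff [NatTrans.IsMonoidal adj.unit]
    [NatTrans.IsMonoidal adj.counit] {u v : U} {b c d r : V} (a : u ⟶ G.obj b) (f : v ⟶ G.obj c)
    (p : b ⊗ c ⟶ d) (m : r ⟶ d) :
    (∃ h : u ⊗ v ⟶ G.obj r, h ≫ G.map m = (a ⊗ₘ f) ≫ μ G b c ≫ G.map p) ↔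
      ∃ h : F.obj u ⊗ F.obj v ⟶ r,
        h ≫ m = ((adj.homEquiv u b).symm a ⊗ₘ (adj.homEquiv v c).symm f) ≫ p := by
  rw [← Category.assoc, factors_map_iff adj, adj.homEquiv_naturality_right_symm,
    ← μ_comp_homEquiv_symm]
  constructor
  · rintro ⟨h, hh⟩
    -- Restrict along the tensorator of `F`.
    exact ⟨μ F u v ≫ h, by rw [Category.assoc, hh, Category.assoc]⟩
  · rintro ⟨h, hh⟩
    -- Precompose with the section of `μ F u v`, which undoes that restriction.
    exact ⟨(adj.homEquiv _ _).symm ((adj.unit.app u ⊗ₘ adj.unit.app v) ≫ μ G _ _) ≫ h, by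
      rw [Category.assoc, hh, Category.assoc, ← Category.assoc, adjoint_tensorators_comp_μ,
        Category.id_comp]⟩

end Adjunction

/-! ### Change of base of sieves and coverages -/

section ChangeBase

variable {U : Type u₁} [Category.{w} U] [MonoidalCategory U] [SymmetricCategory U]
  [MonoidalClosed U] {V : Type u₂} [Category.{w} V] [MonoidalCategory V] [SymmetricCategory V]
  [MonoidalClosed V] {F : U ⥤ V} {G : V ⥤ U} [G.LaxMonoidal] (adj : F ⊣ G)
  {C : Type u₃} [EnrichedCategory V C]

/-- The identification `changeBaseYo` has identity components, so it disappears from the inclusion.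
-/
lemma MonoInto.app_changeBase_ι {x : C} (r : MonoInto (yo (V := V) x)) (z : C) :
    app (C := TransportEnrichment G C) (r.changeBase adj).ι z = G.map (app r.ι z) :=
  Category.comp_id _

lemma MonoInto.factors_changeBase_iff {x : C} (r : MonoInto (yo (V := V) x)) (z : C) {u : U}
    (a : u ⟶ G.obj (z ⟶[V] x)) :
    (∃ k : u ⟶ G.obj (r.dom.at' z),
        k ≫ app (C := TransportEnrichment G C) (r.changeBase adj).ι z = a) ↔
      ∃ k : F.obj u ⟶ r.dom.at' z, k ≫ app r.ι z = (adj.homEquiv u _).symm a := by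
  rw [MonoInto.app_changeBase_ι]
  exact factors_map_iff adj _ a

/-- Change of base preserves maximal sieves. -/
lemma Sieve.changeBase_top (x : C) :
    Sieve.changeBase adj (Sieve.top (V := V) x) =
      Sieve.top (V := U) (C := TransportEnrichment G C) x := by
  let t : MonoInto (yo (V := V) x) := ⟨yo x, 𝟙 _, fun _ => inferInstanceAs (Mono (𝟙 _))⟩
  have e (z : C) : app (C := TransportEnrichment G C) (t.changeBase adj).ι z =
      𝟙 (G.obj (z ⟶[V] x)) :=
    (MonoInto.app_changeBase_ι adj t z).trans (G.map_id _)
  exact Quotient.sound (MonoInto.equiv_of_factors _ _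
    (fun z => ⟨𝟙 (G.obj (_ ⟶[V] x)), (Category.comp_id _).trans (e z).symm⟩)
    (fun z => ⟨𝟙 (G.obj (_ ⟶[V] x)), (Category.id_comp _).trans (e z)⟩))

variable [F.LaxMonoidal] [NatTrans.IsMonoidal adj.unit] [NatTrans.IsMonoidal adj.counit]

variable [HasPullbacks U] [HasPullbacks V]

/-- Change of base commutes with pullback along a generalized element `f` of `G(C(y,x))`, where
on `C` one pulls back along the transpose of `f`. -/
lemma Sieve.pull_changeBase {x y : C} (R : Sieve V x) {g : U} (f : g ⟶ G.obj (y ⟶[V] x)) :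
    Sieve.changeBase adj (R.pull ((adj.homEquiv _ _).symm f)) =
      Sieve.pull (C := TransportEnrichment G C) (x := x) (y := y) f (R.changeBase adj) := by
  induction R using Quotient.inductionOn with
  | _ r =>
    refine Quotient.sound (MonoInto.equiv_of_factors_iff _ _ fun z u a => ?_)
    -- Transpose `a` to `C`, unfold the pullback there, return to `U` by the tensorator comparison,
    -- and fold the pullback on `G_*C`. The last step uses that composition in `G_*C` is by
    -- definition `μ G` followed by `G.map` of composition in `C`.
    refine (MonoInto.factors_changeBase_iff (C := C) adj _ z a).trans
      ((MonoInto.factors_pull_iff _ r _ _).trans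
        ((factors_tensorHom_comp_map_iff adj a f _ _).symm.trans
          (Iff.trans (exists_congr fun h => ?_) (MonoInto.factors_pull_iff
            (C := TransportEnrichment G C) (x := x) (y := y) f (r.changeBase adj) z a).symm)))
    exact (congrArg (h ≫ ·) (MonoInto.app_changeBase_ι (C := C) adj r z)).symm.congr_left

/-- Coverages are stable under change of base along a monoidal adjunction. -/
lemma IsCoverage.changeBaseFamily {𝒢U : ObjectProperty U} {𝒢V : ObjectProperty V}
    (h𝒢 : ∀ g : U, 𝒢U g → 𝒢V (F.obj g)) {J : ∀ x : C, Set (Sieve V x)} (hJ : IsCoverage 𝒢V J) :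
    IsCoverage 𝒢U (EnrichedBase.changeBaseFamily adj J) where
  top_mem x := ⟨Sieve.top _, hJ.top_mem _, Sieve.changeBase_top adj _⟩
  pull_mem := by
    rintro x y _ ⟨R, hR, rfl⟩ g hg f
    -- The preimage in `J` is the pullback of `R` along the transpose `F.obj g ⟶ C(y,x)` of `f`.
    exact ⟨_, hJ.pull_mem _ _ R hR _ (h𝒢 g hg) _, Sieve.pull_changeBase adj R f⟩

end ChangeBase

end EnrichedBase

theorem mainTheorem4
    {U : Type u₁} [Category.{w} U] [MonoidalCategory U] [SymmetricCategory U] [MonoidalClosed U]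
    [EnrichedBase.IsBase U]
    {V : Type u₂} [Category.{w} V] [MonoidalCategory V] [SymmetricCategory V] [MonoidalClosed V]
    [EnrichedBase.IsBase V]
    (F : U ⥤ V) (G : V ⥤ U) [F.LaxMonoidal] [G.LaxMonoidal] (adj : F ⊣ G)
    [NatTrans.IsMonoidal adj.unit] [NatTrans.IsMonoidal adj.counit]
    [G.Faithful] [G.ReflectsIsomorphisms]
    (𝒢U : ObjectProperty U) (h𝒢U : EnrichedBase.IsDenseGeneratingFamily.{w} 𝒢U)
    (𝒢V : ObjectProperty V) (h𝒢V : ∀ g : U, 𝒢U g → 𝒢V (F.obj g))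
    {C : Type u₃} [EnrichedCategory V C]
    (J : ∀ x : C, Set (EnrichedBase.Sieve V x)) (hJ : EnrichedBase.IsCoverage 𝒢V J) :
    EnrichedBase.IsCoverage 𝒢U (EnrichedBase.changeBaseFamily adj J) :=
  hJ.changeBaseFamily adj h𝒢V
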